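/- Let $q,p,k,n\ge 0$ be integers and $\sigma^2>0$. For $i\ge 1$ let $\phi_i(z)=\sqrt2\cos(i\pi z)$, $z\in[-1,1]$, and let $\mathcal G_{2k+1}$ be the finite set of all functions on $[-1,1]^p$ of the form $$g_{\mathcal A}(x)=\prod_{(i,j)\in\mathcal A}\phi_i(x_j),\qquad \mathcal A\subseteq\{1,\dots,q\}\times\{1,\dots,p\},\quad |\mathcal A|\le k+1,$$ where each coordinate is used at most once, i.e. $(i,j)\in\mathcal A$ and $l\ne i$ imply $(l,j)\notin\mathcal A$. Let $\bar g$ be uniformly distributed on $\mathcal G_{2k+1}$, let $x_1,\dots,x_n$ be uniformly distributed on $[-1,1]^p$ and $\epsilon_1,\dots,\epsilon_n\sim N(0,\sigma^2)$, all of them mutually independent, and let $y_i=t(\bar g(x_i)+\epsilon_i)$, where $t:\mathbb R\to\mathcal Y\subseteq\mathbb R$ is a fixed measurable function. Let $\hat g$ be any estimator, i.e. any function-valued measurable function of the sample $(x_1,y_1),\dots,(x_n,y_n)$ and, possibly, of additional randomness that is independent of $(\bar g,x_1,\dots,x_n,\epsilon_1,\dots,\epsilon_n)$ (it is enough that the events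 $\{\hat g=g\}$, $g\in\mathcal G_{2k+1}$, are measurable). If $$n\le\Bigl(\log\Bigl(q^{k+1}\binom{p}{k+1}\Bigr)-2\log 2\Bigr)\frac{\sigma^2}{2}$$ (which is understood to fail when $q^{k+1}\binom{p}{k+1}=0$), then $\mathbb P[\hat g\ne\bar g]\ge\frac12$. -/

import Mathlib

open MeasureTheory ProbabilityTheory
open scoped NNReal

noncomputable section

/-- The domain `[-1,1]^p` of the covariates. -/
abbrev Cube (p : ℕ) : Type := Fin p → Set.Icc (-1 : ℝ) 1

/-- The basis functions `φ_i(z) = √2 cos(iπz)`. -/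
def cosBasis (i : ℕ) (z : ℝ) : ℝ := √2 * Real.cos (i * Real.pi * z)

/-- `g_A(x) = ∏_{(i,j) ∈ A} φ_i(x_j)`. -/
def prodTree {p : ℕ} (A : Finset (ℕ × Fin p)) (x : Cube p) : ℝ :=
  ∏ a ∈ A, cosBasis a.1 (x a.2)

/-- The restricted ensemble `G_{2k+1}`, a set of functions on `[-1,1]^p`: all `g_A` with
`A ⊆ {1,…,q} × {1,…,p}`, `|A| ≤ k+1`, and each covariate used at most once. -/
def ensemble (q p k : ℕ) : Set (Cube p → ℝ) :=
  {g | ∃ A : Finset (ℕ × Fin p),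
    A ⊆ Finset.Icc 1 q ×ˢ Finset.univ ∧ A.card ≤ k + 1 ∧
    (∀ i j, (i, j) ∈ A → ∀ l, l ≠ i → (l, j) ∉ A) ∧ g = prodTree A}

/-- The members of the restricted ensemble, as a type. -/
def Hypothesis (q p k : ℕ) : Type := {g : Cube p → ℝ // g ∈ ensemble q p k}

/-- The ensemble is finite and carries the discrete σ-algebra. -/
instance (q p k : ℕ) : MeasurableSpace (Hypothesis q p k) := ⊤

/-- The uniform distribution on `[-1,1]^p`. -/
def unifCube (p : ℕ) : Measure (Cube p) :=
  Measure.pi fun _ => ProbabilityTheory.cond (Measure.comap Subtype.val volume) Set.univ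

/-- The joint law of the hypothesis, the covariates, the noise variables and the internal
randomness of the estimator: they are mutually independent, the hypothesis is uniform on the
ensemble, each covariate vector is uniform on the cube, each noise variable is `N(0, v)`, and the
internal randomness has law `ρ`. -/
def jointLaw (q p k n : ℕ) (v : ℝ≥0) {R : Type*} [MeasurableSpace R] (ρ : Measure R) :
    Measure (Hypothesis q p k × (Fin n → Cube p) × (Fin n → ℝ) × R) :=
  (uniformOn (Set.univ : Set (Hypothesis q p k))).prod
    ((Measure.pi fun _ => unifCube p).prod
      ((Measure.pi fun _ => gaussianReal 0 v).prod ρ))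

/-- The observed sample `(x_i, y_i)`, `y_i = t(g(x_i) + ε_i)`, `i = 1, …, n`. -/
def observedSample {p n : ℕ} {Y : Set ℝ} (t : ℝ → Y) (g : Cube p → ℝ)
    (x : Fin n → Cube p) (ε : Fin n → ℝ) : Fin n → Cube p × Y :=
  fun i => (x i, t (g (x i) + ε i))

end

/-! The proof is Fano's inequality with the zero function as reference. The functions `φ_i` together
with the constant `1` are orthonormal, hence so are their products over coordinates. Orthonormality
is used twice. Distinct index vectors give distinct functions, so the ensemble has at least `q^(k+1)
* p.choose (k+1)` members (`le_card_hypothesis`). Each member has norm one, so its sample has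
relative entropy `n / (2σ²)` with respect to pure noise (`integrable_logRatio_and_integral_eq`). The
sample under `g` is pure noise shifted by the values of `g`, which is a Gaussian change of measure.
The decision regions of the estimator on pure noise are disjoint, so their probabilities sum to at
most one; `fano_of_changeOfMeasure` turns this and the entropy bound into a bound on the average
success probability. For `n` in the stated range it is at most `1/2`. -/

/-- The uniform distribution on `[-1,1]`. -/
noncomputable def unifIcc : Measure (Set.Icc (-1 : ℝ) 1) :=
  ProbabilityTheory.cond (Measure.comap Subtype.val volume) Set.univ

lemma comap_volume_Icc_univ :
    (Measure.comap Subtype.val volume : Measure (Set.Icc (-1 : ℝ) 1)) Set.univ = 2 := by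
  rw [(MeasurableEmbedding.subtype_coe measurableSet_Icc).comap_apply,
    Set.image_univ, Subtype.range_coe, Real.volume_Icc]
  norm_num

instance : IsProbabilityMeasure unifIcc := by
  refine cond_isProbabilityMeasure_of_finite ?_ ?_ <;> rw [comap_volume_Icc_univ] <;> simp

instance (p : ℕ) : IsProbabilityMeasure (unifCube p) :=
  inferInstanceAs (IsProbabilityMeasure (Measure.pi fun _ : Fin p => unifIcc))

lemma integral_unifIcc (f : ℝ → ℝ) :
    ∫ z, f z ∂unifIcc = (1 / 2) * ∫ z in (-1 : ℝ)..1, f z := by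
  rw [unifIcc, ProbabilityTheory.cond, integral_smul_measure, comap_volume_Icc_univ,
    Measure.restrict_univ, integral_subtype_comap measurableSet_Icc,
    intervalIntegral.integral_of_le (by norm_num), integral_Icc_eq_integral_Ioc]
  simp

lemma integral_cos_int_mul_pi (m : ℤ) (hm : m ≠ 0) :
    ∫ z in (-1 : ℝ)..1, Real.cos (m * Real.pi * z) = 0 := by
  have h : (m * Real.pi : ℝ) ≠ 0 := mul_ne_zero (by exact_mod_cast hm) Real.pi_ne_zero
  rw [intervalIntegral.integral_comp_mul_left (fun z => Real.cos z) h, integral_cos]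
  simp [Real.sin_int_mul_pi]

/-! ### Orthonormality of the product functions. -/

/-- The cosine basis completed by the constant function `1` at index `0`. -/
noncomputable def coordFun (i : ℕ) (z : ℝ) : ℝ := if i = 0 then 1 else cosBasis i z

lemma continuous_coordFun (i : ℕ) : Continuous (coordFun i) := by
  unfold coordFun cosBasis
  split_ifs <;> fun_prop

lemma integral_coordFun_mul (i l : ℕ) :
    ∫ z, coordFun i z * coordFun l z ∂unifIcc = if i = l then 1 else 0 := by
  rw [integral_unifIcc (fun z => coordFun i z * coordFun l z)]
  have key : ∀ i : ℕ, i ≠ 0 → ∫ z in (-1 : ℝ)..1, cosBasis i z = 0 := by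
    intro i hi
    unfold cosBasis
    rw [intervalIntegral.integral_const_mul]
    have := integral_cos_int_mul_pi i (by exact_mod_cast hi)
    simp only [Int.cast_natCast] at this
    simp [this]
  by_cases hi : i = 0 <;> by_cases hl : l = 0
  · subst hi hl
    simp [coordFun]
    norm_num
  · subst hi
    simp [coordFun, hl, key, Ne.symm hl]
  · subst hl
    simp [coordFun, hi, key]
  · have h : ∀ z : ℝ, coordFun i z * coordFun l z =
        Real.cos (((i : ℤ) - l : ℤ) * Real.pi * z) + Real.cos (((i : ℤ) + l : ℤ) * Real.pi * z) := by
      intro z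
      simp only [coordFun, hi, hl, if_false, cosBasis]
      have e1 : (((i : ℤ) - l : ℤ) : ℝ) * Real.pi * z = i * Real.pi * z - l * Real.pi * z := by
        push_cast; ring
      have e2 : (((i : ℤ) + l : ℤ) : ℝ) * Real.pi * z = i * Real.pi * z + l * Real.pi * z := by
        push_cast; ring
      rw [e1, e2, Real.cos_sub, Real.cos_add]
      have := Real.mul_self_sqrt (show (0 : ℝ) ≤ 2 by norm_num)
      linear_combination Real.cos (i * Real.pi * z) * Real.cos (l * Real.pi * z) * this
    simp_rw [h]
    rw [intervalIntegral.integral_add (Continuous.intervalIntegrable (by fun_prop) _ _)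
      (Continuous.intervalIntegrable (by fun_prop) _ _),
      integral_cos_int_mul_pi (i + l) (by omega)]
    split_ifs with hil
    · subst hil
      simp
      norm_num
    · rw [integral_cos_int_mul_pi _ (by omega)]
      simp

/-- The product function in which coordinate `j` enters through the basis function of index `a j`,
index `0` meaning that it is not used. -/
noncomputable def codeFun {p : ℕ} (a : Fin p → ℕ) (x : Cube p) : ℝ := ∏ j, coordFun (a j) (x j)

lemma continuous_codeFun {p : ℕ} (a : Fin p → ℕ) : Continuous (codeFun a) := by
  refine continuous_finsetProd _ fun j _ => (continuous_coordFun (a j)).comp ?_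
  fun_prop

lemma integral_codeFun_mul {p : ℕ} (a b : Fin p → ℕ) :
    ∫ x, codeFun a x * codeFun b x ∂unifCube p = if a = b then 1 else 0 := by
  simp_rw [codeFun, ← Finset.prod_mul_distrib]
  have h := integral_fintype_prod_eq_prod (μ := fun _ : Fin p => unifIcc)
    (fun j (z : Set.Icc (-1 : ℝ) 1) => coordFun (a j) z * coordFun (b j) z)
  refine (h.trans ?_)
  simp_rw [integral_coordFun_mul, Finset.prod_ite_zero, Finset.prod_const_one, funext_iff]
  simp

/-- Orthonormal functions with different indices cannot coincide: the inner product would be both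
`1` and `0`. -/
lemma codeFun_injective {p : ℕ} : Function.Injective (codeFun (p := p)) := by
  intro a b hab
  by_contra hne
  have h1 := integral_codeFun_mul a a
  have h2 := integral_codeFun_mul a b
  rw [← hab, h1] at h2
  simp [hne] at h2

/-! ### Counting the ensemble. -/

/-- Each coordinate occurs in at most one pair of `A`, so the sum has at most one term; the empty
sum is `0`, the index of the constant function. -/
lemma prodTree_eq_codeFun {p : ℕ} {A : Finset (ℕ × Fin p)}
    (h1 : ∀ a ∈ A, a.1 ≠ 0)
    (h2 : ∀ i j, (i, j) ∈ A → ∀ l, l ≠ i → (l, j) ∉ A) :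
    prodTree A = codeFun fun j => ∑ a ∈ A with a.2 = j, a.1 := by
  classical
  funext x
  unfold prodTree codeFun
  rw [← Finset.prod_fiberwise A (fun a => a.2)]
  refine Finset.prod_congr rfl fun j _ => ?_
  rcases (A.filter fun a => a.2 = j).eq_empty_or_nonempty with h | ⟨⟨i, j'⟩, h⟩
  · simp [h, coordFun]
  · have hm := Finset.mem_filter.1 h
    obtain rfl : j' = j := hm.2
    have : A.filter (fun a => a.2 = j') = {(i, j')} := by
      ext ⟨l, j''⟩
      simp only [Finset.mem_filter, Finset.mem_singleton, Prod.mk.injEq]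
      constructor
      · rintro ⟨h3, rfl⟩
        refine ⟨?_, rfl⟩
        by_contra hl
        exact h2 i j'' hm.1 l hl h3
      · rintro ⟨rfl, rfl⟩
        exact hm
    simp only [this, Finset.prod_singleton, Finset.sum_singleton]
    rw [coordFun, if_neg (h1 _ hm.1)]

lemma exists_codeFun_of_mem_ensemble {q p k : ℕ} {g : Cube p → ℝ} (hg : g ∈ ensemble q p k) :
    ∃ a : Fin p → ℕ, g = codeFun a := by
  obtain ⟨A, hA, -, h, rfl⟩ := hg
  refine ⟨_, prodTree_eq_codeFun (fun a ha => ?_) h⟩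
  have := hA ha
  simp at this
  omega

lemma codeFun_mem_ensemble {q p k : ℕ} {S : Finset (Fin p)} (hS : S.card = k + 1)
    {a : Fin p → ℕ} (ha : a ∈ Fintype.piFinset fun j => if j ∈ S then Finset.Icc 1 q else {0}) :
    codeFun a ∈ ensemble q p k := by
  classical
  rw [Fintype.mem_piFinset] at ha
  have hinj : Function.Injective fun j : Fin p => (a j, j) := fun i j h => (Prod.mk.inj h).2
  refine ⟨S.image fun j => (a j, j), ?_, ?_, ?_, ?_⟩
  · intro b hb
    obtain ⟨j, hj, rfl⟩ := Finset.mem_image.1 hb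
    have := ha j
    rw [if_pos hj] at this
    exact Finset.mem_product.2 ⟨this, Finset.mem_univ _⟩
  · rw [Finset.card_image_of_injective _ hinj, hS]
  · intro i j h l hl h'
    obtain ⟨j1, -, h1⟩ := Finset.mem_image.1 h
    obtain ⟨j2, -, h2⟩ := Finset.mem_image.1 h'
    simp only [Prod.mk.injEq] at h1 h2
    obtain ⟨rfl, rfl⟩ := h1
    obtain ⟨rfl, rfl⟩ := h2
    exact hl rfl
  · funext x
    rw [prodTree, Finset.prod_image (fun i _ j _ h => hinj h), codeFun,
      ← Finset.prod_subset (Finset.subset_univ S)]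
    · refine Finset.prod_congr rfl fun j hj => ?_
      have := ha j
      rw [if_pos hj, Finset.mem_Icc] at this
      rw [coordFun, if_neg (by omega)]
    · intro j _ hj
      have := ha j
      rw [if_neg hj, Finset.mem_singleton] at this
      simp [coordFun, this]

lemma finite_ensemble (q p k : ℕ) : (ensemble q p k).Finite := by
  classical
  refine ((((Finset.Icc 1 q ×ˢ (Finset.univ : Finset (Fin p))).powerset).image
    prodTree).finite_toSet).subset ?_
  rintro g ⟨A, hA, -, -, rfl⟩
  exact Finset.mem_coe.2 (Finset.mem_image_of_mem _ (Finset.mem_powerset.2 hA))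

instance (q p k : ℕ) : Finite (Hypothesis q p k) := (finite_ensemble q p k).to_subtype

instance (q p k : ℕ) : Nonempty (Hypothesis q p k) :=
  ⟨⟨prodTree ∅, ∅, by simp, by simp, by simp, rfl⟩⟩

lemma le_card_hypothesis (q p k : ℕ) :
    q ^ (k + 1) * p.choose (k + 1) ≤ Nat.card (Hypothesis q p k) := by
  classical
  let s := (Finset.powersetCard (k + 1) (Finset.univ : Finset (Fin p))).sigma fun S =>
    Fintype.piFinset fun j => if j ∈ S then Finset.Icc 1 q else {0}
  have hs : s.card = q ^ (k + 1) * p.choose (k + 1) := by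
    rw [Finset.card_sigma, Finset.sum_congr rfl (g := fun _ => q ^ (k + 1))]
    · simp [mul_comm]
    · intro S hS
      rw [Fintype.card_piFinset]
      simp_rw [apply_ite Finset.card]
      simp [(Finset.mem_powersetCard.1 hS).2]
  rw [← hs, ← Nat.card_eq_finsetCard]
  have hmem : ∀ c : s, c.1.1.card = k + 1 ∧ c.1.2 ∈ Fintype.piFinset fun j =>
      if j ∈ c.1.1 then Finset.Icc 1 q else {0} := fun c => by
    have := Finset.mem_sigma.1 c.2
    exact ⟨(Finset.mem_powersetCard.1 this.1).2, this.2⟩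
  refine Nat.card_le_card_of_injective (fun c : s => (⟨codeFun c.1.2,
    codeFun_mem_ensemble (hmem c).1 (hmem c).2⟩ : Hypothesis q p k)) fun c d hcd => ?_
  have hcode : c.1.2 = d.1.2 := codeFun_injective (congrArg Subtype.val hcd)
  -- Indices on the chosen set start at `1`, so the set is recovered as the support of the code.
  have hsupp : ∀ c : s, ∀ j, j ∈ c.1.1 ↔ c.1.2 j ≠ 0 := fun c j => by
    have := Fintype.mem_piFinset.1 (hmem c).2 j
    split_ifs at this with h
    · have := (Finset.mem_Icc.1 this).1
      exact iff_of_true h (by omega)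
    · exact iff_of_false h (not_not.2 (Finset.mem_singleton.1 this))
  refine Subtype.ext (Sigma.ext ?_ (heq_of_eq hcode))
  ext j
  rw [hsupp c, hsupp d, hcode]

/-! ### Gaussian change of measure. -/

/-- Translation invariance of Lebesgue measure; the exponential is the ratio of the densities at `m
+ e` and `e`. -/
lemma lintegral_gaussianReal_shift {v : ℝ≥0} (hv : v ≠ 0) (m : ℝ) {f : ℝ → ENNReal}
    (hf : Measurable f) :
    ∫⁻ e, f (m + e) * ENNReal.ofReal (Real.exp (-(m * e / v + m ^ 2 / (2 * v))))
      ∂gaussianReal 0 v = ∫⁻ y, f y ∂gaussianReal 0 v := by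
  rw [gaussianReal_of_var_ne_zero _ hv,
    lintegral_withDensity_eq_lintegral_mul _ (measurable_gaussianPDF 0 v) (by fun_prop),
    lintegral_withDensity_eq_lintegral_mul _ (measurable_gaussianPDF 0 v) hf,
    ← lintegral_add_left_eq_self (gaussianPDF 0 v * f) m]
  refine lintegral_congr fun e => ?_
  have h : gaussianPDF 0 v (m + e) =
      gaussianPDF 0 v e * ENNReal.ofReal (Real.exp (-(m * e / v + m ^ 2 / (2 * v)))) := by
    rw [gaussianPDF, gaussianPDF, ← ENNReal.ofReal_mul (gaussianPDFReal_nonneg _ _ _),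
      gaussianPDFReal, gaussianPDFReal, mul_assoc _ (Real.exp _), ← Real.exp_add]
    congr 3
    have : (v : ℝ) ≠ 0 := by exact_mod_cast hv
    field_simp
    ring
  simp only [Pi.mul_apply, h]
  ring

lemma lintegral_pi_gaussianReal_shift {ι : Type*} [Fintype ι] {v : ℝ≥0} (hv : v ≠ 0) (m : ι → ℝ)
    {f : (ι → ℝ) → ENNReal} (hf : Measurable f) :
    ∫⁻ e, f (m + e) * ENNReal.ofReal (Real.exp (-∑ i, (m i * e i / v + m i ^ 2 / (2 * v))))
      ∂Measure.pi (fun _ => gaussianReal 0 v) = ∫⁻ y, f y ∂Measure.pi fun _ => gaussianReal 0 v := by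
  let w : (ι → ℝ) → ENNReal := fun e =>
    ENNReal.ofReal (Real.exp (-∑ i, (m i * e i / v + m i ^ 2 / (2 * v))))
  have hw : Measurable w := by fun_prop
  -- A product measure is determined by boxes, and on boxes both the indicator and the weight factor
  -- over coordinates.
  have hpi : ((Measure.pi fun _ : ι => gaussianReal 0 v).withDensity w).map (fun e => m + e) =
      Measure.pi fun _ => gaussianReal 0 v := by
    refine (Measure.pi_eq fun s hs => ?_).symm
    have hS : MeasurableSet (Set.univ.pi s) := MeasurableSet.univ_pi hs
    rw [← lintegral_indicator_one hS, lintegral_map (measurable_one.indicator hS) (by fun_prop),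
      lintegral_withDensity_eq_lintegral_mul _ hw
        (show Measurable fun e => (Set.univ.pi s).indicator (1 : (ι → ℝ) → ENNReal) (m + e) from
          (measurable_one.indicator hS).comp (by fun_prop))]
    have hprod : ∀ e : ι → ℝ, (w * fun e : ι → ℝ => (Set.univ.pi s).indicator (1 : (ι → ℝ) → ENNReal) (m + e) :
          (ι → ℝ) → ENNReal) e =
        ∏ i, ((s i).indicator 1 (m i + e i) *
          ENNReal.ofReal (Real.exp (-(m i * e i / v + m i ^ 2 / (2 * v))))) := by
      intro e
      rw [Finset.prod_mul_distrib, ← ENNReal.ofReal_prod_of_nonneg (fun _ _ => (Real.exp_pos _).le),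
        ← Real.exp_sum, Finset.sum_neg_distrib, Pi.mul_apply, mul_comm]
      congr 1
      classical
      simp [Set.indicator_apply, Finset.prod_ite_zero]
    have hm : ∀ i, Measurable fun e : ℝ => (s i).indicator (1 : ℝ → ENNReal) (m i + e) *
          ENNReal.ofReal (Real.exp (-(m i * e / v + m i ^ 2 / (2 * v)))) := fun i =>
      ((measurable_one.indicator (hs i)).comp (by fun_prop)).mul (by fun_prop)
    rw [lintegral_congr hprod, lintegral_prod_eq_prod_lintegral_of_indepFun
      (X := fun i (e : ι → ℝ) => (s i).indicator (1 : ℝ → ENNReal) (m i + e i) *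
          ENNReal.ofReal (Real.exp (-(m i * e i / v + m i ^ 2 / (2 * v)))))
      Finset.univ (iIndepFun_pi fun i => (hm i).aemeasurable)
      (fun i => (hm i).comp (measurable_pi_apply i))]
    refine Finset.prod_congr rfl fun i _ => ?_
    rw [(measurePreserving_eval (fun _ : ι => gaussianReal 0 v) i).lintegral_comp (hm i),
      lintegral_gaussianReal_shift hv (m i) (measurable_one.indicator (hs i)),
      lintegral_indicator_one (hs i)]
  conv_rhs => rw [← hpi, lintegral_map hf (by fun_prop),
    lintegral_withDensity_eq_lintegral_mul _ hw
      (show Measurable fun e => f (m + e) by fun_prop)]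
  exact lintegral_congr fun e => mul_comm _ _

/-! ### Fano's inequality. -/

/-- Young's inequality for the relative entropy: a bound for the probability of an event under a
change of measure with log-likelihood ratio `L`. -/
lemma log_mul_measureReal_preimage_le {Ω : Type*} [MeasurableSpace Ω] (μ : Measure Ω)
    [IsProbabilityMeasure μ] {T : Ω → Ω} (hT : Measurable T) {L : Ω → ℝ} (hL : Measurable L)
    (hLi : Integrable L μ)
    (hTL : ∀ F : Ω → ENNReal, Measurable F →
      ∫⁻ ω, F (T ω) * ENNReal.ofReal (Real.exp (-L ω)) ∂μ = ∫⁻ ω, F ω ∂μ)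
    {B : Set Ω} (hB : MeasurableSet B) {M : ℝ} (hM : 1 ≤ M) :
    Real.log M * μ.real (T ⁻¹' B) ≤
      Real.log 2 - 1 + ∫ ω, L ω ∂μ + (1 + (M - 1) * μ.real B) / 2 := by
  -- This is `exp (log M * 1_B - log 2)`, since `M ^ 1_B = 1 + (M - 1) * 1_B`.
  let F : Ω → ℝ := fun ω => (1 + (M - 1) * B.indicator 1 ω) / 2
  have hFm : Measurable F := by
    have : Measurable (B.indicator (1 : Ω → ℝ)) := measurable_one.indicator hB
    fun_prop
  have hF0 : ∀ ω, 0 ≤ F ω := fun ω => by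
    have : 0 ≤ B.indicator (1 : Ω → ℝ) ω := Set.indicator_nonneg (fun _ _ => zero_le_one) ω
    have := mul_nonneg (sub_nonneg.2 hM) this
    simp only [F]
    linarith
  have hBi : Integrable (B.indicator (1 : Ω → ℝ)) μ := (integrable_const (1 : ℝ)).indicator hB
  have hFi : Integrable F μ := ((integrable_const _).add (hBi.const_mul _)).div_const _
  have hFint : ∫ ω, F ω ∂μ = (1 + (M - 1) * μ.real B) / 2 := by
    simp only [F]
    rw [integral_div, integral_add (integrable_const _) (hBi.const_mul _), integral_const_mul,
      integral_indicator_one hB]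
    simp
  let W : Ω → ℝ := fun ω => F (T ω) * Real.exp (-L ω)
  have hWm : Measurable W := by fun_prop
  have hW0 : ∀ ω, 0 ≤ W ω := fun ω => mul_nonneg (hF0 _) (Real.exp_pos _).le
  have hWF : ∫⁻ ω, ENNReal.ofReal (W ω) ∂μ = ∫⁻ ω, ENNReal.ofReal (F ω) ∂μ := by
    rw [← hTL _ hFm.ennreal_ofReal]
    exact lintegral_congr fun ω => ENNReal.ofReal_mul (hF0 _)
  have hWi : Integrable W μ := by
    refine ⟨hWm.aestronglyMeasurable, ?_⟩
    rw [hasFiniteIntegral_iff_ofReal (.of_forall hW0), hWF,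
      ← hasFiniteIntegral_iff_ofReal (.of_forall hF0)]
    exact hFi.2
  have hWint : ∫ ω, W ω ∂μ = ∫ ω, F ω ∂μ := by
    rw [integral_eq_lintegral_of_nonneg_ae (.of_forall hW0) hWm.aestronglyMeasurable,
      integral_eq_lintegral_of_nonneg_ae (.of_forall hF0) hFm.aestronglyMeasurable, hWF]
  have hTB := hT hB
  have hTBi : Integrable ((T ⁻¹' B).indicator (1 : Ω → ℝ)) μ :=
    (integrable_const (1 : ℝ)).indicator hTB
  -- `W` is a single exponential, bounded below by `1 + u ≤ exp u`; integrating gives the claim.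
  have hpt : ∀ ω, 1 - Real.log 2 + Real.log M * (T ⁻¹' B).indicator 1 ω - L ω ≤ W ω := by
    intro ω
    have hexp : W ω = Real.exp (Real.log M * (T ⁻¹' B).indicator 1 ω - Real.log 2 - L ω) := by
      rw [sub_eq_add_neg _ (L ω), Real.exp_add, Real.exp_sub, Real.exp_log two_pos]
      simp only [W, F]
      congr 2
      by_cases h : T ω ∈ B
      · simp [h, Real.exp_log (zero_lt_one.trans_le hM)]
      · simp [h]
    rw [hexp]
    have := Real.add_one_le_exp (Real.log M * (T ⁻¹' B).indicator 1 ω - Real.log 2 - L ω)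
    linarith
  have := integral_mono (((integrable_const (1 - Real.log 2)).add
    (hTBi.const_mul (Real.log M))).sub hLi) hWi hpt
  rw [hWint, hFint, integral_sub' ((integrable_const _).add (hTBi.const_mul _)) hLi,
    integral_add' (integrable_const _) (hTBi.const_mul _), integral_const_mul,
    integral_indicator_one hTB] at this
  simp only [integral_const, probReal_univ, one_smul] at this
  linarith

/-- **Fano's inequality** for a finite family of changes of measure whose relative entropies are at
most `κ`. -/
lemma fano_of_changeOfMeasure {Ω ι : Type*} [MeasurableSpace Ω] [Fintype ι] [Nonempty ι]
    (μ : Measure Ω) [IsProbabilityMeasure μ] {T : ι → Ω → Ω} (hT : ∀ g, Measurable (T g))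
    {L : ι → Ω → ℝ} (hL : ∀ g, Measurable (L g)) (hLi : ∀ g, Integrable (L g) μ)
    (hTL : ∀ g, ∀ F : Ω → ENNReal, Measurable F →
      ∫⁻ ω, F (T g ω) * ENNReal.ofReal (Real.exp (-L g ω)) ∂μ = ∫⁻ ω, F ω ∂μ)
    {κ : ℝ} (hκ : ∀ g, ∫ ω, L g ω ∂μ ≤ κ)
    {B : ι → Set Ω} (hB : ∀ g, MeasurableSet (B g)) (hd : Pairwise (Function.onFun Disjoint B)) :
    Real.log (Fintype.card ι) * ∑ g, μ.real (T g ⁻¹' B g) ≤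
      Fintype.card ι * (Real.log 2 + κ) := by
  have hM : (1 : ℝ) ≤ Fintype.card ι := by exact_mod_cast Fintype.card_pos
  have hsum : ∑ g, μ.real (B g) ≤ 1 := by
    rw [← measureReal_iUnion_fintype hd hB]
    exact measureReal_le_one
  have h : ∀ g, Real.log (Fintype.card ι) * μ.real (T g ⁻¹' B g) ≤
      (Real.log 2 - 1 / 2 + κ) + ((Fintype.card ι : ℝ) - 1) / 2 * μ.real (B g) := fun g => by
    have := log_mul_measureReal_preimage_le μ (hT g) (hL g) (hLi g) (hTL g) (hB g) hM
    linarith [hκ g]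
  have := Finset.sum_le_sum fun g (_ : g ∈ Finset.univ) => h g
  rw [← Finset.mul_sum, Finset.sum_add_distrib, ← Finset.mul_sum, Finset.sum_const,
    Finset.card_univ, nsmul_eq_mul] at this
  -- Disjointness bounds the last term by `(M - 1) / 2`, with `M` the number of hypotheses, which
  -- the `-1/2` in each summand absorbs.
  nlinarith [mul_le_mul_of_nonneg_left hsum (sub_nonneg.2 hM)]

/-! ### Likelihood ratio and relative entropy of the regression sample. -/

/-- The joint law of the covariates, the noise variables and the internal randomness. -/
noncomputable def sampleLaw (p n : ℕ) (v : ℝ≥0) {R : Type*} [MeasurableSpace R] (ρ : Measure R) :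
    Measure ((Fin n → Cube p) × (Fin n → ℝ) × R) :=
  (Measure.pi fun _ => unifCube p).prod ((Measure.pi fun _ => gaussianReal 0 v).prod ρ)

instance (p n : ℕ) (v : ℝ≥0) {R : Type*} [MeasurableSpace R] (ρ : Measure R)
    [IsProbabilityMeasure ρ] : IsProbabilityMeasure (sampleLaw p n v ρ) :=
  inferInstanceAs (IsProbabilityMeasure (Measure.prod _ _))

/-- The regression values at the covariates are added to the noise. -/
def signalShift {p n : ℕ} {R : Type*} (g : Cube p → ℝ) (ω : (Fin n → Cube p) × (Fin n → ℝ) × R) :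
    (Fin n → Cube p) × (Fin n → ℝ) × R :=
  (ω.1, (fun i => g (ω.1 i)) + ω.2.1, ω.2.2)

/-- The log-likelihood ratio of the regression function `g` against the zero function, at the
sample generated by `g`. -/
noncomputable def logRatio {p n : ℕ} (v : ℝ≥0) {R : Type*} (g : Cube p → ℝ)
    (ω : (Fin n → Cube p) × (Fin n → ℝ) × R) : ℝ :=
  ∑ i, (g (ω.1 i) * ω.2.1 i / v + g (ω.1 i) ^ 2 / (2 * v))

section

variable {p n : ℕ} {v : ℝ≥0} {R : Type*} [MeasurableSpace R]

lemma measurable_signalShift {g : Cube p → ℝ} (hg : Measurable g) :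
    Measurable (signalShift (n := n) (R := R) g) := by
  unfold signalShift
  refine measurable_fst.prodMk (Measurable.prodMk ?_ (by fun_prop))
  refine measurable_pi_lambda _ fun i => ?_
  simp only [Pi.add_apply]
  fun_prop

lemma measurable_logRatio {g : Cube p → ℝ} (hg : Measurable g) :
    Measurable (logRatio (n := n) (R := R) v g) := by
  unfold logRatio
  fun_prop

variable (ρ : Measure R) [IsProbabilityMeasure ρ]

lemma lintegral_signalShift_mul_exp (hv : v ≠ 0) {g : Cube p → ℝ} (hg : Measurable g)
    {F : (Fin n → Cube p) × (Fin n → ℝ) × R → ENNReal} (hF : Measurable F) :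
    ∫⁻ ω, F (signalShift g ω) * ENNReal.ofReal (Real.exp (-logRatio v g ω))
      ∂sampleLaw p n v ρ = ∫⁻ ω, F ω ∂sampleLaw p n v ρ := by
  have hT := measurable_signalShift (n := n) (R := R) hg
  have hL := measurable_logRatio (n := n) (R := R) (v := v) hg
  have hW : Measurable fun ω : (Fin n → Cube p) × (Fin n → ℝ) × R =>
      F (signalShift g ω) * ENNReal.ofReal (Real.exp (-logRatio v g ω)) := by fun_prop
  rw [sampleLaw, lintegral_prod _ hW.aemeasurable, lintegral_prod _ hF.aemeasurable]
  refine lintegral_congr fun x => ?_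
  have hWx : Measurable fun y : (Fin n → ℝ) × R =>
      F (signalShift g (x, y)) * ENNReal.ofReal (Real.exp (-logRatio v g (x, y))) :=
    hW.comp measurable_prodMk_left
  have hFx : Measurable fun y : (Fin n → ℝ) × R => F (x, y) := hF.comp measurable_prodMk_left
  rw [lintegral_prod_symm' _ hWx, lintegral_prod_symm' _ hFx]
  refine lintegral_congr fun u => ?_
  exact lintegral_pi_gaussianReal_shift hv (fun i => g (x i))
    (f := fun e => F (x, e, u)) (by fun_prop)

/-- The linear terms vanish because the noise is centred and independent of the covariates; each
quadratic term contributes `1 / (2v)` by normalization. -/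
lemma integrable_logRatio_and_integral_eq {g : Cube p → ℝ} (hg : Continuous g)
    (hg2 : ∫ z, g z * g z ∂unifCube p = 1) :
    Integrable (logRatio v g) (sampleLaw p n v ρ) ∧
      ∫ ω, logRatio v g ω ∂sampleLaw p n v ρ = n / (2 * (v : ℝ)) := by
  have hgi : ∀ {f : Cube p → ℝ}, Continuous f → Integrable f (unifCube p) := fun hf => by
    have := hf.continuousOn.integrableOn_compact (μ := unifCube p) isCompact_univ
    rwa [integrableOn_univ] at this
  have hx : ∀ {f : Cube p → ℝ}, Continuous f → ∀ i : Fin n,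
      Integrable (fun x : Fin n → Cube p => f (x i)) (Measure.pi fun _ => unifCube p) :=
    fun hf i => integrable_comp_eval (hgi hf)
  have he : ∀ i : Fin n, Integrable (fun e : (Fin n → ℝ) × R => e.1 i)
      ((Measure.pi fun _ => gaussianReal 0 v).prod ρ) := fun i => by
    have : Integrable (fun e : Fin n → ℝ => e i) (Measure.pi fun _ => gaussianReal 0 v) :=
      integrable_comp_eval (X := fun _ => ℝ) (i := i) (f := fun e : ℝ => e)
        ((memLp_id_gaussianReal 1).integrable (by simp))
    exact this.comp_fst ρ
  have he0 : ∀ i : Fin n, ∫ e : (Fin n → ℝ) × R, e.1 i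
      ∂((Measure.pi fun _ => gaussianReal 0 v).prod ρ) = 0 := fun i => by
    rw [integral_fun_fst (fun e : Fin n → ℝ => e i),
      integral_comp_eval (X := fun _ => ℝ) (i := i) (f := fun e : ℝ => e) (by fun_prop), integral_id_gaussianReal]
    simp
  have h1 : ∀ i : Fin n, Integrable (fun ω : (Fin n → Cube p) × (Fin n → ℝ) × R =>
      g (ω.1 i) * ω.2.1 i / v) (sampleLaw p n v ρ) := fun i =>
    ((hx hg i).mul_prod (he i)).div_const _
  have h2 : ∀ i : Fin n, Integrable (fun ω : (Fin n → Cube p) × (Fin n → ℝ) × R =>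
      g (ω.1 i) ^ 2 / (2 * v)) (sampleLaw p n v ρ) := fun i =>
    ((hx (hg.pow 2) i).comp_fst _).div_const _
  have i1 : ∀ i : Fin n, ∫ ω : (Fin n → Cube p) × (Fin n → ℝ) × R,
      g (ω.1 i) * ω.2.1 i / v ∂sampleLaw p n v ρ = 0 := fun i => by
    rw [integral_div, sampleLaw, integral_prod_mul (fun x : Fin n → Cube p => g (x i))
      (fun e : (Fin n → ℝ) × R => e.1 i), he0]
    simp
  have i2 : ∀ i : Fin n, ∫ ω : (Fin n → Cube p) × (Fin n → ℝ) × R,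
      g (ω.1 i) ^ 2 / (2 * v) ∂sampleLaw p n v ρ = 1 / (2 * (v : ℝ)) := fun i => by
    rw [integral_div, sampleLaw, integral_fun_fst (fun x : Fin n → Cube p => g (x i) ^ 2),
      integral_comp_eval (X := fun _ => Cube p) (i := i) (f := fun z : Cube p => g z ^ 2) (hg.pow 2).aestronglyMeasurable]
    simp_rw [sq, hg2]
    simp
  unfold logRatio
  refine ⟨integrable_finsetSum _ fun i _ => (h1 i).add (h2 i), ?_⟩
  refine (integral_finsetSum _ fun i _ => (h1 i).add (h2 i)).trans ?_
  simp_rw [fun i => integral_add' (h1 i) (h2 i), i1, i2]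
  simp [div_eq_mul_inv]

end

/-! ### Averaging over the hypotheses and conclusion. -/

lemma jointLaw_real_eq {q p k n : ℕ} {v : ℝ≥0} {R : Type*} [MeasurableSpace R] (ρ : Measure R)
    [IsProbabilityMeasure ρ] [Fintype (Hypothesis q p k)]
    {S : Set (Hypothesis q p k × (Fin n → Cube p) × (Fin n → ℝ) × R)} (hS : MeasurableSet S) :
    (jointLaw q p k n v ρ).real S =
      (∑ g, (sampleLaw p n v ρ).real {ω | (g, ω) ∈ S}) / Fintype.card (Hypothesis q p k) := by
  have hu : uniformOn (Set.univ : Set (Hypothesis q p k)) =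
      (Fintype.card (Hypothesis q p k) : ENNReal)⁻¹ • Measure.count := by
    rw [uniformOn, ProbabilityTheory.cond, Measure.restrict_univ, Measure.count_univ,
      ENat.card_eq_coe_fintype_card]
    simp
  have h : jointLaw q p k n v ρ S = (Fintype.card (Hypothesis q p k) : ENNReal)⁻¹ *
      ∑ g, sampleLaw p n v ρ {ω | (g, ω) ∈ S} := by
    change (uniformOn (Set.univ : Set (Hypothesis q p k))).prod (sampleLaw p n v ρ) S = _
    rw [Measure.prod_apply hS, hu, lintegral_smul_measure, lintegral_count, tsum_fintype]
    rfl
  rw [measureReal_def, h, ENNReal.toReal_mul, ENNReal.toReal_sum (fun _ _ => measure_ne_top _ _),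
    ENNReal.toReal_inv, ENNReal.toReal_natCast, div_eq_inv_mul]
  rfl

theorem theorem2
    (q p k n : ℕ) (σsq : ℝ≥0) (hσ : 0 < σsq)
    (Y : Set ℝ) (t : ℝ → Y) (ht : Measurable t)
    {Ω : Type*} [MeasurableSpace Ω] (P : Measure Ω) [IsProbabilityMeasure P]
    {R : Type*} [MeasurableSpace R] (ρ : Measure R) [IsProbabilityMeasure ρ]
    (gbar : Ω → Hypothesis q p k) (x : Ω → Fin n → Cube p) (ε : Ω → Fin n → ℝ) (U : Ω → R)
    (hlaw : HasLaw (fun ω => (gbar ω, x ω, ε ω, U ω)) (jointLaw q p k n σsq ρ) P)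
    -- a possibly randomized, possibly improper estimator; the events `ĝ = g` are measurable
    (est : (Fin n → Cube p × Y) × R → (Cube p → ℝ))
    (hest : ∀ g ∈ ensemble q p k, MeasurableSet {s | est s = g})
    (hn : (n : ℝ) ≤
      (Real.log ((q : ℝ) ^ (k + 1) * (p.choose (k + 1) : ℝ)) - 2 * Real.log 2) * σsq / 2) :
    1 / 2 ≤ P.real
      {ω | est (observedSample t (gbar ω).val (x ω) (ε ω), U ω) ≠ (gbar ω).val} := by
  classical
  have : Fintype (Hypothesis q p k) := Fintype.ofFinite _
  have hv : σsq ≠ 0 := hσ.ne'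
  have hv' : (0 : ℝ) < σsq := by exact_mod_cast hσ
  have hcont : ∀ g : Hypothesis q p k, Continuous g.val := fun g => by
    obtain ⟨a, ha⟩ := exists_codeFun_of_mem_ensemble g.2
    exact ha ▸ continuous_codeFun a
  have hnorm : ∀ g : Hypothesis q p k, ∫ z, g.val z * g.val z ∂unifCube p = 1 := fun g => by
    obtain ⟨a, ha⟩ := exists_codeFun_of_mem_ensemble g.2
    rw [ha, integral_codeFun_mul, if_pos rfl]
  -- Decision regions on pure noise; their preimages under `signalShift` are the success events
  -- under `g`.
  let B : Hypothesis q p k → Set ((Fin n → Cube p) × (Fin n → ℝ) × R) := fun g =>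
    {ω | est (observedSample t 0 ω.1 ω.2.1, ω.2.2) = g.val}
  have hB : ∀ g, MeasurableSet (B g) := fun g => by
    refine (hest g.val g.2).preimage (f := fun ω : (Fin n → Cube p) × (Fin n → ℝ) × R =>
      (observedSample t 0 ω.1 ω.2.1, ω.2.2)) ?_
    unfold observedSample
    fun_prop
  have hd : Pairwise (Function.onFun Disjoint B) := fun g h hgh =>
    Set.disjoint_left.2 fun ω h1 h2 => hgh (Subtype.ext (h1.symm.trans h2))
  have hfano := fano_of_changeOfMeasure (sampleLaw p n σsq ρ)
    (T := fun g : Hypothesis q p k => signalShift g.val)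
    (fun g => measurable_signalShift (hcont g).measurable)
    (L := fun g : Hypothesis q p k => logRatio σsq g.val)
    (fun g => measurable_logRatio (hcont g).measurable)
    (fun g => (integrable_logRatio_and_integral_eq ρ (hcont g) (hnorm g)).1)
    (fun g F hF => lintegral_signalShift_mul_exp ρ hv (hcont g).measurable hF)
    (fun g => (integrable_logRatio_and_integral_eq ρ (hcont g) (hnorm g)).2.le) hB hd
  have hpre : ∀ g : Hypothesis q p k, signalShift g.val ⁻¹' B g =
      {ω | est (observedSample t g.val ω.1 ω.2.1, ω.2.2) = g.val} := fun g => by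
    ext ω
    have : observedSample t 0 ω.1 ((fun i => g.val (ω.1 i)) + ω.2.1) =
        observedSample t g.val ω.1 ω.2.1 := by
      funext i
      simp [observedSample]
    simp [B, signalShift, this]
  simp_rw [hpre] at hfano
  let S : Set (Hypothesis q p k × (Fin n → Cube p) × (Fin n → ℝ) × R) :=
    {s | est (observedSample t s.1.val s.2.1 s.2.2.1, s.2.2.2) = s.1.val}
  have hS : MeasurableSet S := by
    have : S = ⋃ g, {g} ×ˢ (signalShift g.val ⁻¹' B g) := by
      ext s
      simp [S, hpre, Set.mem_prod]
    rw [this]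
    exact MeasurableSet.iUnion fun g => (MeasurableSet.of_discrete).prod
      (measurable_signalShift (hcont g).measurable (hB g))
  have hPS : P.real {ω | (gbar ω, x ω, ε ω, U ω) ∈ S} = _ :=
    (hlaw.measureReal_eq hS).trans (jointLaw_real_eq ρ hS)
  have hcompl : P.real {ω | est (observedSample t (gbar ω).val (x ω) (ε ω), U ω) ≠ (gbar ω).val} =
      1 - P.real {ω | (gbar ω, x ω, ε ω, U ω) ∈ S} := by
    have hnull : NullMeasurableSet {ω | (gbar ω, x ω, ε ω, U ω) ∈ S} P :=
      hlaw.aemeasurable.nullMeasurableSet_preimage hS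
    rw [← probReal_compl_eq_one_sub₀ hnull]
    rfl
  rw [hcompl, hPS]
  set M : ℕ := Fintype.card (Hypothesis q p k) with hMdef
  have hM0 : (0 : ℝ) < M := by exact_mod_cast Fintype.card_pos
  set N : ℝ := (q : ℝ) ^ (k + 1) * (p.choose (k + 1) : ℝ) with hN
  have hNM : N ≤ M := by
    have := le_card_hypothesis q p k
    rw [Nat.card_eq_fintype_card] at this
    rw [hN]
    exact_mod_cast this
  have hl2 : 0 < Real.log 2 := Real.log_pos one_lt_two
  -- Forced by `0 ≤ n`. It also excludes `N = 0`, because `Real.log 0 = 0`.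
  have hlogN : 2 * Real.log 2 ≤ Real.log N := by
    have h0 : (0 : ℝ) ≤ n := n.cast_nonneg
    by_contra! hlt
    nlinarith [mul_pos (sub_pos.2 hlt) hv']
  have hN0 : 0 < N := by
    refine lt_of_le_of_ne (by positivity) fun h => ?_
    rw [← h, Real.log_zero] at hlogN
    linarith
  have hlogM : Real.log N ≤ Real.log M := Real.log_le_log hN0 hNM
  have hκ : (n : ℝ) / (2 * σsq) ≤ (Real.log N - 2 * Real.log 2) / 4 := by
    rw [div_le_div_iff₀ (by positivity) (by norm_num)]
    linarith
  have hlogM0 : 0 < Real.log M := by linarith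
  have hle : (∑ g : Hypothesis q p k, (sampleLaw p n σsq ρ).real {ω | (g, ω) ∈ S}) / M ≤ 1 / 2 := by
    rw [div_le_iff₀ hM0]
    refine le_of_mul_le_mul_left (hfano.trans ?_) hlogM0
    -- The left side is at most `log 2 / 2 + log M / 4`, and `2 * log 2 ≤ log M`.
    have : Real.log 2 + (n : ℝ) / (2 * σsq) ≤ Real.log M / 2 := by linarith
    nlinarith [mul_le_mul_of_nonneg_left this hM0.le]
  linarith
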